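/- \textbf{Setting.} Fix an infinite set $FN$ of free names, an infinite set $PN$ of public names, constructors (some of them private), event symbols, and destructors $g$, each given by a finite set of reductions $g(N_1,\dots,N_k)\to N$ whose terms contain no free names and satisfy $\mathrm{var}(N)\subseteq\bigcup_i\mathrm{var}(N_i)$. Processes are those of the applied $\pi$-calculus: $0$, $P\mid Q$, $!P$, $\mathsf{in}(M,x).P$, $\mathsf{out}(M,N).P$, $(\nu a)P$, $\mathsf{if}\ M=N\ \mathsf{then}\ P\ \mathsf{else}\ Q$, $\mathsf{let}\ x=g(M_1,\dots,M_k)\ \mathsf{in}\ P\ \mathsf{else}\ Q$, $\mathsf{event}(F(M_1,\dots,M_k)).P$. A configuration $(\mathcal E,\mathcal P,\delta)$ consists of the set of generated names, the multiset of running closed processes and the frame of messages output so far. The deduction relation $\nu\mathcal E.\delta\vdash t$ is the smallest one that contains all public names, all free names not in $\mathcal E$ and the messages in $\delta$, and that is closed under non-private constructors and under reductions of destructors. The transitions, silent except for events, are: remove $0$; split $P\mid Q$; unfold $!P$ into $P,!P$; replace the bound name of $(\nu a)P$ by some $b\in FN\setminus\mathcal E$ and add $b$ to $\mathcal E$; execute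 $\mathsf{out}(t,M).P$, adding $M$ to the frame, if $t$ is deducible; continue $\mathsf{in}(t,x).P$ with $P\{M/x\}$ for deducible $M$ if $t$ is deducible; take the appropriate branch of a conditional or $\mathsf{let}$; execute an event $F(t_1,\dots,t_k)$, which labels the transition. $\mathit{traces}(P)$ is the set of sequences of events $F_1,\dots,F_n$ such that $(\emptyset,\{P\},\emptyset)\xRightarrow{F_1}\cdots\xRightarrow{F_n}$ some configuration, where $\xRightarrow{F}$ is $\to^*\xrightarrow{F}\to^*$. \textbf{Graphs.} A labeled property graph $G$ is a directed multigraph whose finitely many nodes $V$ are public names. Nodes carry labels among $\mathsf{IP},\mathsf{Dom},\mathsf{AS},\mathsf{Cntry},\mathsf{Provider},\mathsf{MX},\mathsf{RES},\mathsf{DNS},\mathsf{RNS}$ (a node may carry several; a single one is a special case), edges carry one label among $\mathsf{ORIG},\mathsf{LOC},\mathsf{A},\mathsf{MX},\mathsf{NS},\mathsf{DNS},\mathsf{RES},\mathsf{RTE}(t)$ ($t$ a name), and nodes and edges carry string values for keys. Write $V_x$ for the nodes labeled $x$, $y\to z$ for an edge with any label, and $y\xrightarrow{L}z$ for an edge labeled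 $L$. Write $\mathrm{loc}(d,i,a)$ for $d\xrightarrow{\mathsf A}i\xrightarrow{\mathsf{ORIG}}a$ and $\mathrm{con}(a,t,a')$ for $a=a'\vee a\xrightarrow{\mathsf{RTE}(t)}a'$. \textbf{The compiled process.} Let $P_{\mathrm{cl}}(\vec c,\vec s,\vec r)$, $P_{\mathrm{srv}}(\vec s,\vec c)$, $P_{\mathrm{res}}(\vec r,\vec c,\vec d,\vec o)$, $P_{\mathrm{ns}}(\vec d,\vec r)$, $P_{\mathrm{rns}}(\vec o,\vec r)$ be any processes (SMTP client, SMTP server, resolver, name server, root name server) with no free variables other than the displayed parameters, where a mail client $\vec c$ or server $\vec s$ is a 4-tuple (provider, domain, address, AS), and a resolver $\vec r$, name server $\vec d$ or root server $\vec o$ is a triple (domain, address, AS). $\mathcal F(G)$ is the parallel composition, over all $v\in V_{\mathsf{Provider}}$, of \begin{itemize} \item $!P_{\mathrm{cl}}((v,d,i,a),(v_2,e,j,a_1),(r,k,a_2))$ for all $d,i,a,e,j,a_1\in V_{\mathsf{MX}}$, $r,k,a_2\in V_{\mathsf{RES}}$, $t_1,t_2\in V$, $v_2\in V_{\mathsf{Provider}}$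 with $v\to d$, $\mathrm{loc}(d,i,a)$, $v_2\to e$, $\mathrm{loc}(e,j,a_1)$, $\mathrm{con}(a_1,t_1,a)$, $\mathrm{loc}(r,k,a_2)$, $\mathrm{con}(a_2,t_2,a)$; \item $!P_{\mathrm{srv}}((v,d,i,a),(v_2,e,j,a_1))$ for all $d,i,a,e,j,a_1\in V_{\mathsf{MX}}$, $t\in V$, $v_2\in V_{\mathsf{Provider}}$ with $v\to d$, $\mathrm{loc}(d,i,a)$, $v_2\to e$, $\mathrm{loc}(e,j,a_1)$, $\mathrm{con}(a_1,t,a)$; \item $!P_{\mathrm{res}}((d,i,a),(v,e,j,a_1),(n,k,a_2),(n',k',a_3))$ for all $d,i,a\in V_{\mathsf{RES}}$, $e,j,a_1\in V_{\mathsf{MX}}$, $n,k,a_2\in V_{\mathsf{DNS}}$, $n',k',a_3\in V_{\mathsf{RNS}}$, $t_1,t_2,t_3\in V$ with $v\to d$, $\mathrm{loc}(d,i,a)$, $v\to e$, $\mathrm{loc}(e,j,a_1)$, $\mathrm{con}(a_1,t_1,a)$, $\mathrm{loc}(n,k,a_2)$, $\mathrm{con}(a_2,t_2,a)$, $\mathrm{loc}(n',k',a_3)$,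 $\mathrm{con}(a_3,t_3,a)$; \item $!P_{\mathrm{ns}}((d,i,a),(r,j,a_1))$ for all $d,i,a\in V_{\mathsf{DNS}}$, $r,j,a_1\in V_{\mathsf{RES}}$, $t\in V$ with $v\to d$, $\mathrm{loc}(d,i,a)$, $\mathrm{loc}(r,j,a_1)$, $\mathrm{con}(a_1,t,a)$; \item $!P_{\mathrm{rns}}((d,i,a),(r,j,a_1))$ for all $d,i,a\in V_{\mathsf{RNS}}$, $r,j,a_1\in V_{\mathsf{RES}}$, $t\in V$ with $v\to d$, $\mathrm{loc}(d,i,a)$, $\mathrm{loc}(r,j,a_1)$, $\mathrm{con}(a_1,t,a)$. \end{itemize} \textbf{The graph-independent process.} Let $c$ be a public name, and write $\mathsf{in}(x)$ for $\mathsf{in}(c,x)$. Let $P'_{\mathrm{cl}}(\mathit{prov},\mathit{dom},\mathit{ip},\mathit{as})$, $P'_{\mathrm{srv}}(\mathit{prov},\mathit{dom},\mathit{ip},\mathit{as})$, $P'_{\mathrm{res}}(\mathit{dom},\mathit{ip},\mathit{as})$, $P'_{\mathrm{ns}}(\mathit{dom},\mathit{ip},\mathit{as})$, $P'_{\mathrm{rns}}(\mathit{dom},\mathit{ip},\mathit{as})$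 be obtained from the processes above by keeping only the first tuple as parameters and, for each remaining parameter $x$ one after the other, prefixing exactly one subprocess (anywhere in the process) that contains all occurrences of $x$ with the input $\mathsf{in}(x)$. Put $$P=\;!\,\mathsf{in}(\mathit{prov}).\Big(N(P'_{\mathrm{cl}})\mid N(P'_{\mathrm{srv}})\mid N(P'_{\mathrm{res}})\mid N(P'_{\mathrm{ns}})\mid N(P'_{\mathrm{rns}})\Big),$$ where $N(Q)=\;!\,\mathsf{in}(\mathit{dom}).\mathsf{in}(\mathit{ip}).\mathsf{in}(\mathit{as}).\,!\,Q$. \textbf{Theorem.} For every labeled property graph $G$, $\mathit{traces}(\mathcal F(G))\subseteq\mathit{traces}(P)$. -/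

import Mathlib

universe u v

namespace InfraTrace

/-- The symbols of the calculus: free names, public names, constructors (some of them private),
destructors and event symbols, with their arities. -/
structure Signature where
  FN : Type u
  PN : Type u
  infinite_FN : Infinite FN
  infinite_PN : Infinite PN
  Con : Type u
  conArity : Con → ℕ
  priv : Set Con
  Des : Type u
  desArity : Des → ℕ
  Ev : Type u
  evArity : Ev → ℕ

/-- Terms whose variables are among `n` many, numbered `0, …, n - 1`. -/
inductive Term (S : Signature.{u}) (n : ℕ) : Type u
  | var (x : Fin n) : Term S n
  | free (a : S.FN) : Term S n
  | pub (p : S.PN) : Term S n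
  | con (f : S.Con) (ts : Fin (S.conArity f) → Term S n) : Term S n

namespace Term

variable {S : Signature.{u}} {n m : ℕ}

/-- Simultaneous substitution. -/
def subst (σ : Fin n → Term S m) : Term S n → Term S m
  | .var x => σ x
  | .free a => .free a
  | .pub p => .pub p
  | .con f ts => .con f (fun i => (ts i).subst σ)

/-- The same term, regarded in a context with one more (last) variable, which does not occur. -/
def weaken (t : Term S n) : Term S (n + 1) := t.subst (fun x => .var x.castSucc)

/-- The variables of a term. -/
def vars : Term S n → Set (Fin n)
  | .var x => {x}
  | .free _ => ∅
  | .pub _ => ∅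
  | .con _ ts => ⋃ i, (ts i).vars

/-- The free names of a term. -/
def freeNames : Term S n → Set S.FN
  | .var _ => ∅
  | .free a => {a}
  | .pub _ => ∅
  | .con _ ts => ⋃ i, (ts i).freeNames

end Term

/-- A reduction `g(N₁, …, N_k) → N` of a `k`-ary destructor. -/
structure Reduction (S : Signature.{u}) (k : ℕ) where
  nvars : ℕ
  lhs : Fin k → Term S nvars
  rhs : Term S nvars
  lhs_freeNames : ∀ i, (lhs i).freeNames = ∅
  rhs_freeNames : rhs.freeNames = ∅
  vars_subset : rhs.vars ⊆ ⋃ i, (lhs i).vars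

/-- A signature together with the finite sets of reductions defining the destructors. -/
structure Calculus extends Signature.{u} where
  defn : (g : toSignature.Des) → Set (Reduction toSignature (toSignature.desArity g))
  defn_finite : ∀ g, (defn g).Finite

/-- Processes whose free variables are among `n` many, numbered `0, …, n - 1`. A binder occurring
in a process over `n` variables binds the variable number `n` of its continuation. The bound name of
a restriction is treated as a bound variable, to be replaced by the generated name; so processes
are considered up to renaming of bound names and variables. -/
inductive Proc (S : Signature.{u}) : ℕ → Type u
  | nil {n : ℕ} : Proc S n
  | par {n : ℕ} (P Q : Proc S n) : Proc S n
  | repl {n : ℕ} (P : Proc S n) : Proc S n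
  | inp {n : ℕ} (M : Term S n) (P : Proc S (n + 1)) : Proc S n
  | out {n : ℕ} (M N : Term S n) (P : Proc S n) : Proc S n
  | new {n : ℕ} (P : Proc S (n + 1)) : Proc S n
  | ite {n : ℕ} (M N : Term S n) (P Q : Proc S n) : Proc S n
  | letd {n : ℕ} (g : S.Des) (Ms : Fin (S.desArity g) → Term S n)
      (P : Proc S (n + 1)) (Q : Proc S n) : Proc S n
  | event {n : ℕ} (F : S.Ev) (Ms : Fin (S.evArity F) → Term S n) (P : Proc S n) : Proc S n

/-- The substitution to be used below a binder. -/
def liftSubst {S : Signature.{u}} {n m : ℕ} (σ : Fin n → Term S m) :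
    Fin (n + 1) → Term S (m + 1) :=
  Fin.snoc (α := fun _ => Term S (m + 1)) (fun x => (σ x).weaken) (.var (Fin.last m))

namespace Proc

variable {S : Signature.{u}}

/-- Simultaneous substitution (capture-avoiding). -/
def subst : {n m : ℕ} → (Fin n → Term S m) → Proc S n → Proc S m
  | _, _, _, .nil => .nil
  | _, _, σ, .par P Q => .par (P.subst σ) (Q.subst σ)
  | _, _, σ, .repl P => .repl (P.subst σ)
  | _, _, σ, .inp M P => .inp (M.subst σ) (P.subst (liftSubst σ))
  | _, _, σ, .out M N P => .out (M.subst σ) (N.subst σ) (P.subst σ)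
  | _, _, σ, .new P => .new (P.subst (liftSubst σ))
  | _, _, σ, .ite M N P Q => .ite (M.subst σ) (N.subst σ) (P.subst σ) (Q.subst σ)
  | _, _, σ, .letd g Ms P Q =>
      .letd g (fun i => (Ms i).subst σ) (P.subst (liftSubst σ)) (Q.subst σ)
  | _, _, σ, .event F Ms P => .event F (fun i => (Ms i).subst σ) (P.subst σ)

/-- The same process, regarded in a context with one more (last) variable, which does not occur
free in it. -/
def weaken {n : ℕ} (P : Proc S n) : Proc S (n + 1) := P.subst (fun x => .var x.castSucc)

/-- Exchange the last two variables. -/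
def swapLast {n : ℕ} (P : Proc S (n + 2)) : Proc S (n + 2) :=
  P.subst (fun x => .var (Equiv.swap (Fin.last n).castSucc (Fin.last (n + 1)) x))

/-- Replace the only free variable by the closed term `M`. -/
def inst (P : Proc S 1) (M : Term S 0) : Proc S 0 := P.subst (fun _ => M)

/-- Replace the free variables by public names: the instance `P(p₀, …, p_{n-1})`. -/
def call {n : ℕ} (P : Proc S n) (p : Fin n → S.PN) : Proc S 0 := P.subst (fun x => .pub (p x))

end Proc

/-- Events `F(t₁, …, t_k)`. -/
structure Event (S : Signature.{u}) where
  sym : S.Ev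
  args : Fin (S.evArity sym) → Term S 0

/-- The deduction relation `ν E. δ ⊢ t`. The frame `δ` is the list of messages output so far, the
`i`-th entry being the value of the `i`-th frame variable. -/
inductive Deduces (C : Calculus.{u}) (E : Set C.FN) (δ : List (Term C.toSignature 0)) :
    Term C.toSignature 0 → Prop
  | free (a : C.FN) (ha : a ∉ E) : Deduces C E δ (.free a)
  | pub (p : C.PN) : Deduces C E δ (.pub p)
  | frame (t : Term C.toSignature 0) (ht : t ∈ δ) : Deduces C E δ t
  | con (f : C.Con) (hf : f ∉ C.priv) (ts : Fin (C.conArity f) → Term C.toSignature 0)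
      (hts : ∀ i, Deduces C E δ (ts i)) : Deduces C E δ (.con f ts)
  | des (g : C.Des) (r : Reduction C.toSignature (C.desArity g)) (hr : r ∈ C.defn g)
      (σ : Fin r.nvars → Term C.toSignature 0)
      (hts : ∀ i, Deduces C E δ ((r.lhs i).subst σ)) : Deduces C E δ (r.rhs.subst σ)

/-- `g(M₁, …, M_k)` evaluates to `t`. -/
def EvalsTo (C : Calculus.{u}) (g : C.Des)
    (Ms : Fin (C.desArity g) → Term C.toSignature 0) (t : Term C.toSignature 0) : Prop :=
  ∃ r ∈ C.defn g, ∃ σ : Fin r.nvars → Term C.toSignature 0,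
    (∀ i, (r.lhs i).subst σ = Ms i) ∧ t = r.rhs.subst σ

/-- Configurations `(E, 𝒫, δ)`: generated names, running processes, frame. -/
structure Config (S : Signature.{u}) where
  names : Set S.FN
  procs : Multiset (Proc S 0)
  frame : List (Term S 0)

/-- Labeled transitions; the label `none` is the empty label. -/
inductive Step (C : Calculus.{u}) :
    Config C.toSignature → Option (Event C.toSignature) → Config C.toSignature → Prop
  | null {E Ps δ} : Step C ⟨E, .nil ::ₘ Ps, δ⟩ none ⟨E, Ps, δ⟩
  | par {E Ps δ} (P Q : Proc C.toSignature 0) :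
      Step C ⟨E, .par P Q ::ₘ Ps, δ⟩ none ⟨E, P ::ₘ Q ::ₘ Ps, δ⟩
  | repl {E Ps δ} (P : Proc C.toSignature 0) :
      Step C ⟨E, .repl P ::ₘ Ps, δ⟩ none ⟨E, P ::ₘ .repl P ::ₘ Ps, δ⟩
  | new {E Ps δ} (P : Proc C.toSignature 1) (b : C.FN) (hb : b ∉ E) :
      Step C ⟨E, .new P ::ₘ Ps, δ⟩ none ⟨insert b E, P.inst (.free b) ::ₘ Ps, δ⟩
  | out {E Ps δ} (t M : Term C.toSignature 0) (P : Proc C.toSignature 0)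
      (ht : Deduces C E δ t) :
      Step C ⟨E, .out t M P ::ₘ Ps, δ⟩ none ⟨E, P ::ₘ Ps, δ ++ [M]⟩
  | inp {E Ps δ} (t M : Term C.toSignature 0) (P : Proc C.toSignature 1)
      (hM : Deduces C E δ M) (ht : Deduces C E δ t) :
      Step C ⟨E, .inp t P ::ₘ Ps, δ⟩ none ⟨E, P.inst M ::ₘ Ps, δ⟩
  | ifTrue {E Ps δ} (M : Term C.toSignature 0) (P Q : Proc C.toSignature 0) :
      Step C ⟨E, .ite M M P Q ::ₘ Ps, δ⟩ none ⟨E, P ::ₘ Ps, δ⟩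
  | ifFalse {E Ps δ} (M N : Term C.toSignature 0) (P Q : Proc C.toSignature 0) (h : M ≠ N) :
      Step C ⟨E, .ite M N P Q ::ₘ Ps, δ⟩ none ⟨E, Q ::ₘ Ps, δ⟩
  | letSucc {E Ps δ} (g : C.Des) (Ms : Fin (C.desArity g) → Term C.toSignature 0)
      (P : Proc C.toSignature 1) (Q : Proc C.toSignature 0) (t : Term C.toSignature 0)
      (ht : EvalsTo C g Ms t) :
      Step C ⟨E, .letd g Ms P Q ::ₘ Ps, δ⟩ none ⟨E, P.inst t ::ₘ Ps, δ⟩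
  | letFail {E Ps δ} (g : C.Des) (Ms : Fin (C.desArity g) → Term C.toSignature 0)
      (P : Proc C.toSignature 1) (Q : Proc C.toSignature 0) (h : ¬ ∃ t, EvalsTo C g Ms t) :
      Step C ⟨E, .letd g Ms P Q ::ₘ Ps, δ⟩ none ⟨E, Q ::ₘ Ps, δ⟩
  | event {E Ps δ} (F : C.Ev) (Ms : Fin (C.evArity F) → Term C.toSignature 0)
      (P : Proc C.toSignature 0) :
      Step C ⟨E, .event F Ms P ::ₘ Ps, δ⟩ (some ⟨F, Ms⟩) ⟨E, P ::ₘ Ps, δ⟩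

/-- Finitely many transitions with the empty label. -/
def SilentSteps (C : Calculus.{u}) : Config C.toSignature → Config C.toSignature → Prop :=
  Relation.ReflTransGen (fun c c' => Step C c none c')

/-- One transition labeled with an event, preceded and followed by silent ones. -/
def EventStep (C : Calculus.{u}) (c : Config C.toSignature) (F : Event C.toSignature)
    (c' : Config C.toSignature) : Prop :=
  ∃ c₁ c₂, SilentSteps C c c₁ ∧ Step C c₁ (some F) c₂ ∧ SilentSteps C c₂ c'

/-- Sequences of event steps. -/
inductive Run (C : Calculus.{u}) :
    Config C.toSignature → List (Event C.toSignature) → Config C.toSignature → Prop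
  | nil (c : Config C.toSignature) : Run C c [] c
  | cons {c c₁ c₂ : Config C.toSignature} {F : Event C.toSignature}
      {Fs : List (Event C.toSignature)} (h : EventStep C c F c₁) (hs : Run C c₁ Fs c₂) :
      Run C c (F :: Fs) c₂

/-- The traces of a closed process. -/
def traces (C : Calculus.{u}) (P : Proc C.toSignature 0) : Set (List (Event C.toSignature)) :=
  {Fs | ∃ c, Run C ⟨∅, {P}, []⟩ Fs c}

/-- The labels of nodes. -/
inductive NodeLabel
  | ip | dom | asys | cntry | provider | mx | res | dns | rns

/-- The labels of edges; `rte t` labels an edge between autonomous systems for a route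
traversing `t`. -/
inductive EdgeLabel (N : Type u)
  | orig | loc | a | mx | ns | dns | res
  | rte (t : N)

/-- Labeled property graphs with a finite set `V` of nodes, which are elements of `N`: directed
multigraphs with node labels (a node may carry several), edge labels, and string values for the keys
of nodes and edges. (Labels and values of elements of `N` outside `V` play no role.) -/
structure PropertyGraph (N : Type u) where
  V : Finset N
  Edge : Type v
  src : Edge → N
  tgt : Edge → N
  src_mem : ∀ e, src e ∈ V
  tgt_mem : ∀ e, tgt e ∈ V
  nodeLabels : N → Set NodeLabel
  edgeLabel : Edge → EdgeLabel N
  Key : Type v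
  value : N ⊕ Edge → Key → String

namespace PropertyGraph

variable {N : Type u} (G : PropertyGraph.{u, v} N)

open Classical in
/-- The nodes labeled `l`. -/
noncomputable def labeled (l : NodeLabel) : Finset N := G.V.filter (fun x => l ∈ G.nodeLabels x)

/-- There is an edge from `x` to `y`. -/
def Adj (x y : N) : Prop := ∃ e, G.src e = x ∧ G.tgt e = y

/-- There is an edge labeled `l` from `x` to `y`. -/
def AdjL (x : N) (l : EdgeLabel N) (y : N) : Prop :=
  ∃ e, G.src e = x ∧ G.tgt e = y ∧ G.edgeLabel e = l

/-- The domain `d` has the address `i`, which originates from the autonomous system `s`. -/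
def Located (d i s : N) : Prop := G.AdjL d .a i ∧ G.AdjL i .orig s

/-- The autonomous systems `s` and `s'` are equal, or there is a route from `s` to `s'`
via `t`. -/
def Connected (s t s' : N) : Prop := s = s' ∨ G.AdjL s (.rte t) s'

end PropertyGraph

/-- The parallel composition of the `P s` for `s` in a finite set (in some order, ended by the nil
process). -/
noncomputable def bigPar {S : Signature.{u}} {α : Type u} (A : Finset α) (P : α → Proc S 0) :
    Proc S 0 :=
  (A.toList.map P).foldr Proc.par Proc.nil

/-- The five protocol subprocesses, as processes in their parameters (concatenated in the order
given), where a mail server is given by provider, domain, address and autonomous system, and a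
resolver, name server or root name server by domain, address and autonomous system. -/
structure Subprocesses (S : Signature.{u}) where
  /-- parameters: client, server, resolver -/
  client : Proc S 11
  /-- parameters: server, client -/
  server : Proc S 8
  /-- parameters: resolver, client, name server, root name server -/
  res : Proc S 13
  /-- parameters: name server, resolver -/
  ns : Proc S 6
  /-- parameters: root name server, resolver -/
  rns : Proc S 6

namespace Subprocesses

variable {S : Signature.{u}} (R : Subprocesses S) (G : PropertyGraph.{u, v} S.PN)

open Classical in
/-- The SMTP client processes of the provider `p`. -/
noncomputable def clientsOf (p : S.PN) : Proc S 0 :=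
  bigPar
    ((G.labeled .mx ×ˢ G.labeled .mx ×ˢ G.labeled .mx ×ˢ
      G.labeled .mx ×ˢ G.labeled .mx ×ˢ G.labeled .mx ×ˢ
      G.labeled .res ×ˢ G.labeled .res ×ˢ G.labeled .res ×ˢ
      G.V ×ˢ G.V ×ˢ G.labeled .provider).filter
      (fun (d, i, s, e, j, s₁, r, k, s₂, t₁, t₂, q) =>
        G.Adj p d ∧ G.Located d i s ∧
        G.Adj q e ∧ G.Located e j s₁ ∧ G.Connected s₁ t₁ s ∧
        G.Located r k s₂ ∧ G.Connected s₂ t₂ s))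
    (fun (d, i, s, e, j, s₁, r, k, s₂, _, _, q) =>
      .repl (R.client.call ![p, d, i, s, q, e, j, s₁, r, k, s₂]))

open Classical in
/-- The SMTP server processes of the provider `p`. -/
noncomputable def serversOf (p : S.PN) : Proc S 0 :=
  bigPar
    ((G.labeled .mx ×ˢ G.labeled .mx ×ˢ G.labeled .mx ×ˢ
      G.labeled .mx ×ˢ G.labeled .mx ×ˢ G.labeled .mx ×ˢ
      G.V ×ˢ G.labeled .provider).filter
      (fun (d, i, s, e, j, s₁, t, q) =>
        G.Adj p d ∧ G.Located d i s ∧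
        G.Adj q e ∧ G.Located e j s₁ ∧ G.Connected s₁ t s))
    (fun (d, i, s, e, j, s₁, _, q) =>
      .repl (R.server.call ![p, d, i, s, q, e, j, s₁]))

open Classical in
/-- The resolver processes of the provider `p`. -/
noncomputable def resolversOf (p : S.PN) : Proc S 0 :=
  bigPar
    ((G.labeled .res ×ˢ G.labeled .res ×ˢ G.labeled .res ×ˢ
      G.labeled .mx ×ˢ G.labeled .mx ×ˢ G.labeled .mx ×ˢ
      G.labeled .dns ×ˢ G.labeled .dns ×ˢ G.labeled .dns ×ˢ
      G.labeled .rns ×ˢ G.labeled .rns ×ˢ G.labeled .rns ×ˢ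
      G.V ×ˢ G.V ×ˢ G.V).filter
      (fun (d, i, s, e, j, s₁, n, k, s₂, n', k', s₃, t₁, t₂, t₃) =>
        G.Adj p d ∧ G.Located d i s ∧
        G.Adj p e ∧ G.Located e j s₁ ∧ G.Connected s₁ t₁ s ∧
        G.Located n k s₂ ∧ G.Connected s₂ t₂ s ∧
        G.Located n' k' s₃ ∧ G.Connected s₃ t₃ s))
    (fun (d, i, s, e, j, s₁, n, k, s₂, n', k', s₃, _, _, _) =>
      .repl (R.res.call ![d, i, s, p, e, j, s₁, n, k, s₂, n', k', s₃]))

open Classical in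
/-- The name server processes of the provider `p`. -/
noncomputable def nameServersOf (p : S.PN) : Proc S 0 :=
  bigPar
    ((G.labeled .dns ×ˢ G.labeled .dns ×ˢ G.labeled .dns ×ˢ
      G.labeled .res ×ˢ G.labeled .res ×ˢ G.labeled .res ×ˢ G.V).filter
      (fun (d, i, s, r, j, s₁, t) =>
        G.Adj p d ∧ G.Located d i s ∧ G.Located r j s₁ ∧ G.Connected s₁ t s))
    (fun (d, i, s, r, j, s₁, _) => .repl (R.ns.call ![d, i, s, r, j, s₁]))

open Classical in
/-- The root name server processes of the provider `p`. -/
noncomputable def rootServersOf (p : S.PN) : Proc S 0 :=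
  bigPar
    ((G.labeled .rns ×ˢ G.labeled .rns ×ˢ G.labeled .rns ×ˢ
      G.labeled .res ×ˢ G.labeled .res ×ˢ G.labeled .res ×ˢ G.V).filter
      (fun (d, i, s, r, j, s₁, t) =>
        G.Adj p d ∧ G.Located d i s ∧ G.Located r j s₁ ∧ G.Connected s₁ t s))
    (fun (d, i, s, r, j, s₁, _) => .repl (R.rns.call ![d, i, s, r, j, s₁]))

/-- The process compiled from the property graph `G`, whose nodes are public names. -/
noncomputable def compile : Proc S 0 :=
  bigPar (G.labeled .provider) (fun p =>
    .par (R.clientsOf G p) (.par (R.serversOf G p) (.par (R.resolversOf G p)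
      (.par (R.nameServersOf G p) (R.rootServersOf G p)))))

end Subprocesses

/-- `InsertInput c Q' Q`, for a process `Q'` with a distinguished last variable `x`: the process `Q`
is obtained from `Q'` by prefixing exactly one subprocess `P` of `Q'` with the input `in(c, x)`, where
`x` does not occur in `Q'` outside of `P`. Thus `Q` contains the subprocess `in(c, x).P`, and `Q'` is
`Q` with `P` instead of this subprocess. -/
inductive InsertInput {S : Signature.{u}} (c : S.PN) :
    {n : ℕ} → Proc S (n + 1) → Proc S n → Prop
  | here {n : ℕ} (P : Proc S (n + 1)) : InsertInput c P (.inp (.pub c) P)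
  | parLeft {n : ℕ} {P : Proc S (n + 1)} {P' : Proc S n} (h : InsertInput c P P')
      (Q : Proc S n) : InsertInput c (.par P Q.weaken) (.par P' Q)
  | parRight {n : ℕ} {P : Proc S (n + 1)} {P' : Proc S n} (h : InsertInput c P P')
      (Q : Proc S n) : InsertInput c (.par Q.weaken P) (.par Q P')
  | repl {n : ℕ} {P : Proc S (n + 1)} {P' : Proc S n} (h : InsertInput c P P') :
      InsertInput c (.repl P) (.repl P')
  | inp {n : ℕ} {P : Proc S (n + 2)} {P' : Proc S (n + 1)} (h : InsertInput c P.swapLast P')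
      (M : Term S n) : InsertInput c (.inp M.weaken P) (.inp M P')
  | out {n : ℕ} {P : Proc S (n + 1)} {P' : Proc S n} (h : InsertInput c P P')
      (M N : Term S n) : InsertInput c (.out M.weaken N.weaken P) (.out M N P')
  | new {n : ℕ} {P : Proc S (n + 2)} {P' : Proc S (n + 1)}
      (h : InsertInput c P.swapLast P') : InsertInput c (.new P) (.new P')
  | iteThen {n : ℕ} {P : Proc S (n + 1)} {P' : Proc S n} (h : InsertInput c P P')
      (M N : Term S n) (Q : Proc S n) :
      InsertInput c (.ite M.weaken N.weaken P Q.weaken) (.ite M N P' Q)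
  | iteElse {n : ℕ} {P : Proc S (n + 1)} {P' : Proc S n} (h : InsertInput c P P')
      (M N : Term S n) (Q : Proc S n) :
      InsertInput c (.ite M.weaken N.weaken Q.weaken P) (.ite M N Q P')
  | letIn {n : ℕ} {P : Proc S (n + 2)} {P' : Proc S (n + 1)} (h : InsertInput c P.swapLast P')
      (g : S.Des) (Ms : Fin (S.desArity g) → Term S n) (Q : Proc S n) :
      InsertInput c (.letd g (fun i => (Ms i).weaken) P Q.weaken) (.letd g Ms P' Q)
  | letElse {n : ℕ} {P : Proc S (n + 1)} {P' : Proc S n} (h : InsertInput c P P')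
      (g : S.Des) (Ms : Fin (S.desArity g) → Term S n) (Q : Proc S (n + 1)) :
      InsertInput c (.letd g (fun i => (Ms i).weaken) Q.weaken.swapLast P) (.letd g Ms Q P')
  | event {n : ℕ} {P : Proc S (n + 1)} {P' : Proc S n} (h : InsertInput c P P')
      (F : S.Ev) (Ms : Fin (S.evArity F) → Term S n) :
      InsertInput c (.event F (fun i => (Ms i).weaken) P) (.event F Ms P')

/-- `InsertInputs c P Q`: starting from `P`, inputs on `c` for the last variables of `P` are inserted,
one after the other and each at one place, until only the free variables of `Q` remain. -/
inductive InsertInputs {S : Signature.{u}} (c : S.PN) {m : ℕ} (P : Proc S m) :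
    {n : ℕ} → Proc S n → Prop
  | refl : InsertInputs c P P
  | step {n : ℕ} {Q' : Proc S (n + 1)} {Q : Proc S n} (h : InsertInputs c P Q')
      (hQ : InsertInput c Q' Q) : InsertInputs c P Q

/-- Protocol subprocesses that are parametrized by the data of their own node only. -/
structure LocalSubprocesses (S : Signature.{u}) where
  /-- parameters: provider, domain, address, autonomous system -/
  client : Proc S 4
  /-- parameters: provider, domain, address, autonomous system -/
  server : Proc S 4
  /-- parameters: domain, address, autonomous system -/
  res : Proc S 3
  /-- parameters: domain, address, autonomous system -/
  ns : Proc S 3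
  /-- parameters: domain, address, autonomous system -/
  rns : Proc S 3

namespace LocalSubprocesses

variable {S : Signature.{u}}

/-- The subprocesses `L` are the subprocesses `R`, except that the data of the communication
partners are not parameters, but are received in inputs on `c`, placed anywhere in the process. -/
structure ReceivesPartners (L : LocalSubprocesses S) (c : S.PN) (R : Subprocesses S) : Prop where
  client : InsertInputs c R.client L.client
  server : InsertInputs c R.server L.server
  res : InsertInputs c R.res L.res
  ns : InsertInputs c R.ns L.ns
  rns : InsertInputs c R.rns L.rns

/-- Below the input of the provider (variable `0`): `!in(c, dom). in(c, ip). in(c, as). !P`, for `P` with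
the parameters provider, domain, address, autonomous system. -/
def receiveNode (c : S.PN) (P : Proc S 4) : Proc S 1 :=
  .repl (.inp (.pub c) (.inp (.pub c) (.inp (.pub c) (.repl P))))

/-- View a process in domain, address, autonomous system as one that also has the
provider as its first parameter. -/
def ignoreProvider (P : Proc S 3) : Proc S 4 := P.subst (fun x => .var x.succ)

/-- The process that does not depend on a graph: the adversary chooses, on the public channel `c`, the
providers and the nodes that run the subprocesses. -/
def model (L : LocalSubprocesses S) (c : S.PN) : Proc S 0 :=
  .repl (.inp (.pub c)
    (.par (receiveNode c L.client)
      (.par (receiveNode c L.server)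
        (.par (receiveNode c (ignoreProvider L.res))
          (.par (receiveNode c (ignoreProvider L.ns))
            (receiveNode c (ignoreProvider L.rns)))))))

end LocalSubprocesses

end InfraTrace

/-!
The model can simulate the compiled process, because all the data that it lacks are public: it consists
of names of nodes of the graph, which the adversary can send on the public channel `c`.

For a single subprocess, `Refines c P Q` says that `Q` becomes `P` when suitable inputs on `c` receive
suitable public names. It relates closed processes only; below a binder, it is required for all instances
by closed terms, so that no substitution lemma for it is needed. Inserting the input for one
parameter preserves refinement (`InsertInput.refines`): the input is to receive the value of this parameter.
Hence an instance of a given subprocess refines the instance of its local version by the data of the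
own node alone (`InsertInputs.refines`).

Runs are simulated by keeping `!B` running, where `!B` is the model. The names generated and the frame
remain the same on both sides, since additional inputs change neither. The compiled process is a
parallel composition of replications `!P`, where `B`, upon receiving the data of a node, unfolds to a
process that `P` refines (`Offers`). Parts of it that are not yet unfolded need no counterpart in the
simulating configuration. Whenever a copy of `P` is split off, `!B` produces its counterpart
silently; and before a transition of `P`, its counterpart executes the additional inputs in front of it, if
any (`Refines.exists_unfolds`). Superfluous processes that arise on the way are harmless. This gives a
weak simulation (`Simulates.step`), and thus inclusion of traces.
-/

namespace InfraTrace

/-! ### Substitution -/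

section Substitution

variable {S : Signature.{u}}

theorem Term.subst_subst {n m k : ℕ} (t : Term S n) (σ : Fin n → Term S m)
    (τ : Fin m → Term S k) : (t.subst σ).subst τ = t.subst (fun x => (σ x).subst τ) := by
  induction t with
  | var x => rfl
  | free a => rfl
  | pub p => rfl
  | con f ts ih => simp only [Term.subst, ih]

theorem Term.weaken_subst {n m : ℕ} (t : Term S n) (τ : Fin (n + 1) → Term S m) :
    t.weaken.subst τ = t.subst (fun x => τ x.castSucc) := by
  rw [Term.weaken, Term.subst_subst]
  rfl

@[simp]
theorem liftSubst_castSucc {n m : ℕ} (σ : Fin n → Term S m) (x : Fin n) :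
    liftSubst σ x.castSucc = (σ x).weaken := by
  simp [liftSubst]

@[simp]
theorem liftSubst_last {n m : ℕ} (σ : Fin n → Term S m) :
    liftSubst σ (Fin.last n) = .var (Fin.last m) := by
  simp [liftSubst]

theorem liftSubst_comp {n m k : ℕ} (σ : Fin n → Term S m) (τ : Fin m → Term S k) :
    (fun x => (liftSubst σ x).subst (liftSubst τ)) = liftSubst (fun x => (σ x).subst τ) := by
  funext x
  refine Fin.lastCases ?_ (fun x => ?_) x
  · simp [Term.subst]
  · rw [liftSubst_castSucc, liftSubst_castSucc, Term.weaken_subst, Term.weaken, Term.subst_subst]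
    congr 1
    funext y
    rw [liftSubst_castSucc, Term.weaken]

theorem Proc.subst_subst {n : ℕ} (P : Proc S n) :
    ∀ {m k : ℕ} (σ : Fin n → Term S m) (τ : Fin m → Term S k),
      (P.subst σ).subst τ = P.subst (fun x => (σ x).subst τ) := by
  induction P <;> intro m k σ τ <;>
    simp_all only [Proc.subst, Term.subst_subst, liftSubst_comp]

/-- The substitution `σ` extended by the value `t` of the last variable. -/
def extend {n m : ℕ} (σ : Fin n → Term S m) (t : Term S m) : Fin (n + 1) → Term S m :=
  Fin.snoc (α := fun _ => Term S m) σ t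

@[simp]
theorem extend_castSucc {n m : ℕ} (σ : Fin n → Term S m) (t : Term S m) (x : Fin n) :
    extend σ t x.castSucc = σ x := by
  simp [extend]

@[simp]
theorem extend_last {n m : ℕ} (σ : Fin n → Term S m) (t : Term S m) :
    extend σ t (Fin.last n) = t := by
  simp [extend]

theorem Term.weaken_subst_extend {n m : ℕ} (M : Term S n) (σ : Fin n → Term S m) (t : Term S m) :
    M.weaken.subst (extend σ t) = M.subst σ := by
  simp [Term.weaken_subst]

theorem Proc.weaken_subst_extend {n m : ℕ} (P : Proc S n) (σ : Fin n → Term S m)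
    (t : Term S m) : P.weaken.subst (extend σ t) = P.subst σ := by
  simp [Proc.weaken, Proc.subst_subst, Term.subst]

theorem Proc.swapLast_subst_extend {n m : ℕ} (P : Proc S (n + 2)) (σ : Fin n → Term S m)
    (s t : Term S m) :
    P.swapLast.subst (extend (extend σ s) t) = P.subst (extend (extend σ t) s) := by
  rw [Proc.swapLast, Proc.subst_subst]
  congr 1
  funext x
  refine Fin.lastCases ?_ (fun x => Fin.lastCases ?_ (fun x => ?_) x) x
  · simp [Term.subst]
  · simp [Term.subst]
  · rw [Equiv.swap_apply_of_ne_of_ne]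
    · simp [Term.subst]
    · simp [Fin.ext_iff, x.isLt.ne]
    · simp only [ne_eq, Fin.ext_iff, Fin.val_castSucc, Fin.val_last]
      omega

theorem Proc.subst_liftSubst_inst {n : ℕ} (P : Proc S (n + 1)) (σ : Fin n → Term S 0)
    (t : Term S 0) : (P.subst (liftSubst σ)).inst t = P.subst (extend σ t) := by
  rw [Proc.inst, Proc.subst_subst]
  congr 1
  funext x
  refine Fin.lastCases ?_ (fun x => ?_) x
  · simp [Term.subst]
  · rw [liftSubst_castSucc, Term.weaken_subst, extend_castSucc]
    -- A substitution of closed terms for no variables is the identity.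
    generalize σ x = s
    induction s with
    | var x => exact x.elim0
    | free a => rfl
    | pub p => rfl
    | con f ts ih => simp only [Term.subst, ih]

end Substitution

/-! ### Processes with additional inputs -/

section AdditionalInputs

variable {S : Signature.{u}}

/-- `Congruent r P Q`: the closed processes `P` and `Q` have the same outermost constructor and the
same terms there, and all their respective immediate continuations are related by `r`, whatever closed
term is bound on entering them. -/
inductive Congruent (r : Proc S 0 → Proc S 0 → Prop) : Proc S 0 → Proc S 0 → Prop
  | nil : Congruent r .nil .nil
  | par {P Q P' Q' : Proc S 0} (hP : r P P') (hQ : r Q Q') :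
      Congruent r (.par P Q) (.par P' Q')
  | repl {P P' : Proc S 0} (hP : r P P') : Congruent r (.repl P) (.repl P')
  | inp (M : Term S 0) {P P' : Proc S 1} (hP : ∀ t, r (P.inst t) (P'.inst t)) :
      Congruent r (.inp M P) (.inp M P')
  | out (M N : Term S 0) {P P' : Proc S 0} (hP : r P P') :
      Congruent r (.out M N P) (.out M N P')
  | new {P P' : Proc S 1} (hP : ∀ t, r (P.inst t) (P'.inst t)) :
      Congruent r (.new P) (.new P')
  | ite (M N : Term S 0) {P Q P' Q' : Proc S 0} (hP : r P P') (hQ : r Q Q') :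
      Congruent r (.ite M N P Q) (.ite M N P' Q')
  | letd (g : S.Des) (Ms : Fin (S.desArity g) → Term S 0) {P P' : Proc S 1} {Q Q' : Proc S 0}
      (hP : ∀ t, r (P.inst t) (P'.inst t)) (hQ : r Q Q') :
      Congruent r (.letd g Ms P Q) (.letd g Ms P' Q')
  | event (F : S.Ev) (Ms : Fin (S.evArity F) → Term S 0) {P P' : Proc S 0} (hP : r P P') :
      Congruent r (.event F Ms P) (.event F Ms P')

/-- `Refines c P Q`, for closed processes: `Q` becomes `P` when suitable inputs on `c` in `Q` receive
suitable public names. Which inputs and which names may depend on the terms bound before. -/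
inductive Refines (c : S.PN) : Proc S 0 → Proc S 0 → Prop
  | congr {P Q : Proc S 0} (h : Congruent (Refines c) P Q) : Refines c P Q
  | skip {P : Proc S 0} {Q : Proc S 1} (p : S.PN) (h : Refines c P (Q.inst (.pub p))) :
      Refines c P (.inp (.pub c) Q)

theorem Refines.subst_self (c : S.PN) {n : ℕ} (P : Proc S n) :
    ∀ σ : Fin n → Term S 0, Refines c (P.subst σ) (P.subst σ) := by
  induction P with
  | nil => exact fun σ => .congr .nil
  | par P Q ihP ihQ => exact fun σ => .congr (.par (ihP σ) (ihQ σ))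
  | repl P ih => exact fun σ => .congr (.repl (ih σ))
  | inp M P ih =>
    refine fun σ => .congr (.inp _ fun t => ?_)
    rw [Proc.subst_liftSubst_inst]
    exact ih _
  | out M N P ih => exact fun σ => .congr (.out _ _ (ih σ))
  | new P ih =>
    refine fun σ => .congr (.new fun t => ?_)
    rw [Proc.subst_liftSubst_inst]
    exact ih _
  | ite M N P Q ihP ihQ => exact fun σ => .congr (.ite _ _ (ihP σ) (ihQ σ))
  | letd g Ms P Q ihP ihQ =>
    refine fun σ => .congr (.letd _ _ (fun t => ?_) (ihQ σ))
    rw [Proc.subst_liftSubst_inst]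
    exact ihP _
  | event F Ms P ih => exact fun σ => .congr (.event _ _ (ih σ))

/-- Inserting one input for the last variable preserves refinement: the inserted input is to receive
the value `p` that the variable had before. -/
theorem InsertInput.refines {c : S.PN} {n : ℕ} {Q' : Proc S (n + 1)} {Q : Proc S n}
    (h : InsertInput c Q' Q) :
    ∀ (p : S.PN) (A : Proc S 0) (σ : Fin n → Term S 0),
      Refines c A (Q'.subst (extend σ (.pub p))) → Refines c A (Q.subst σ) := by
  induction h with
  | here P =>
    intro p A σ hA
    refine .skip p ?_
    rwa [Proc.subst_liftSubst_inst]
  | parLeft h Q ih =>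
    intro p A σ hA
    rw [Proc.subst, Proc.weaken_subst_extend] at hA
    obtain ⟨hA⟩ := hA
    cases hA with
    | par h₁ h₂ => exact .congr (.par (ih p _ σ h₁) h₂)
  | parRight h Q ih =>
    intro p A σ hA
    rw [Proc.subst, Proc.weaken_subst_extend] at hA
    obtain ⟨hA⟩ := hA
    cases hA with
    | par h₁ h₂ => exact .congr (.par h₁ (ih p _ σ h₂))
  | repl h ih =>
    intro p A σ hA
    rw [Proc.subst] at hA
    obtain ⟨hA⟩ := hA
    cases hA with
    | repl h₁ => exact .congr (.repl (ih p _ σ h₁))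
  | @inp n P P' h M ih =>
    have key : ∀ (p : S.PN) (A : Proc S 0) (σ : Fin n → Term S 0) (t : Term S 0),
        Refines c A ((P.subst (liftSubst (extend σ (.pub p)))).inst t) →
          Refines c A ((P'.subst (liftSubst σ)).inst t) := by
      intro p A σ t hA
      rw [Proc.subst_liftSubst_inst] at hA ⊢
      rw [← Proc.swapLast_subst_extend] at hA
      exact ih p A _ hA
    intro p A σ hA
    rw [Proc.subst, Term.weaken_subst_extend] at hA
    rw [Proc.subst]
    generalize M.subst σ = N at hA ⊢
    cases hA with
    | congr hA =>
      cases hA with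
      | inp _ h₁ => exact .congr (.inp _ fun t => key p _ σ t (h₁ t))
    | skip q hA => exact .skip q (key p A σ _ hA)
  | out h M N ih =>
    intro p A σ hA
    rw [Proc.subst, Term.weaken_subst_extend, Term.weaken_subst_extend] at hA
    obtain ⟨hA⟩ := hA
    cases hA with
    | out _ _ h₁ => exact .congr (.out _ _ (ih p _ σ h₁))
  | new h ih =>
    intro p A σ hA
    rw [Proc.subst] at hA
    obtain ⟨hA⟩ := hA
    cases hA with
    | new h₁ =>
      refine .congr (.new fun t => ?_)
      have h₂ := h₁ t
      rw [Proc.subst_liftSubst_inst] at h₂ ⊢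
      rw [← Proc.swapLast_subst_extend] at h₂
      exact ih p _ _ h₂
  | iteThen h M N Q ih =>
    intro p A σ hA
    rw [Proc.subst, Term.weaken_subst_extend, Term.weaken_subst_extend,
      Proc.weaken_subst_extend] at hA
    obtain ⟨hA⟩ := hA
    cases hA with
    | ite _ _ h₁ h₂ => exact .congr (.ite _ _ (ih p _ σ h₁) h₂)
  | iteElse h M N Q ih =>
    intro p A σ hA
    rw [Proc.subst, Term.weaken_subst_extend, Term.weaken_subst_extend,
      Proc.weaken_subst_extend] at hA
    obtain ⟨hA⟩ := hA
    cases hA with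
    | ite _ _ h₁ h₂ => exact .congr (.ite _ _ h₁ (ih p _ σ h₂))
  | letIn h g Ms Q ih =>
    intro p A σ hA
    simp only [Proc.subst, Term.weaken_subst_extend, Proc.weaken_subst_extend] at hA
    obtain ⟨hA⟩ := hA
    cases hA with
    | letd _ _ h₁ h₂ =>
      refine .congr (.letd _ _ (fun t => ?_) h₂)
      have h₃ := h₁ t
      rw [Proc.subst_liftSubst_inst] at h₃ ⊢
      rw [← Proc.swapLast_subst_extend] at h₃
      exact ih p _ _ h₃
  | letElse h g Ms Q ih =>
    intro p A σ hA
    simp only [Proc.subst, Term.weaken_subst_extend] at hA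
    obtain ⟨hA⟩ := hA
    cases hA with
    | letd _ _ h₁ h₂ =>
      refine .congr (.letd _ _ (fun t => ?_) (ih p _ σ h₂))
      have h₃ := h₁ t
      rw [Proc.subst_liftSubst_inst] at h₃ ⊢
      rwa [Proc.swapLast_subst_extend, Proc.weaken_subst_extend] at h₃
  | event h F Ms ih =>
    intro p A σ hA
    simp only [Proc.subst, Term.weaken_subst_extend] at hA
    obtain ⟨hA⟩ := hA
    cases hA with
    | event _ _ h₁ => exact .congr (.event _ _ (ih p _ σ h₁))

/-- The instances of `P` refine those of a process with inputs for some of the parameters. A single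
sequence `v` of names provides the values of the parameters of both processes. -/
theorem InsertInputs.refines_call {c : S.PN} {m n : ℕ} {P : Proc S m} {Q : Proc S n}
    (h : InsertInputs c P Q) (v : ℕ → S.PN) :
    Refines c (P.call fun x => v x) (Q.call fun x => v x) := by
  induction h with
  | refl => exact .subst_self c P _
  | @step n Q' Q h hQ ih =>
    refine hQ.refines (v n) _ _ ?_
    convert ih using 1
    rw [Proc.call]
    congr 1
    funext x
    refine Fin.lastCases ?_ (fun x => ?_) x <;> simp

end AdditionalInputs

/-! ### Silent unfolding by the adversary -/

section Unfolding

variable {C : Calculus.{u}} {c : C.PN}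

/-- `Unfolds c P Q`: the adversary can obtain the process `Q` from the closed process `P`, besides
other ones, by unfolding replications, splitting parallel compositions and sending public names on
`c`. -/
inductive Unfolds {S : Signature.{u}} (c : S.PN) : Proc S 0 → Proc S 0 → Prop
  | refl (P : Proc S 0) : Unfolds c P P
  | parLeft {P Q R : Proc S 0} (h : Unfolds c P R) : Unfolds c (.par P Q) R
  | parRight {P Q R : Proc S 0} (h : Unfolds c Q R) : Unfolds c (.par P Q) R
  | repl {P R : Proc S 0} (h : Unfolds c P R) : Unfolds c (.repl P) R
  | inp {P : Proc S 1} {R : Proc S 0} (p : S.PN) (h : Unfolds c (P.inst (.pub p)) R) :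
      Unfolds c (.inp (.pub c) P) R

theorem Unfolds.silentSteps {P Q : Proc C.toSignature 0} (h : Unfolds c P Q) :
    ∃ Y : Multiset (Proc C.toSignature 0), ∀ E Ps δ,
      SilentSteps C ⟨E, P ::ₘ Ps, δ⟩ ⟨E, Q ::ₘ (Y + Ps), δ⟩ := by
  induction h with
  | refl P => exact ⟨0, fun E Ps δ => by rw [zero_add]; exact .refl⟩
  | @parLeft P Q R h ih =>
    obtain ⟨Y, hY⟩ := ih
    refine ⟨Y + {Q}, fun E Ps δ => .head (.par P Q) ?_⟩
    rw [add_assoc, Multiset.singleton_add]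
    exact hY E _ δ
  | @parRight P Q R h ih =>
    obtain ⟨Y, hY⟩ := ih
    refine ⟨Y + {P}, fun E Ps δ => .head (.par P Q) ?_⟩
    rw [add_assoc, Multiset.singleton_add, Multiset.cons_swap]
    exact hY E _ δ
  | @repl P R h ih =>
    obtain ⟨Y, hY⟩ := ih
    refine ⟨Y + {.repl P}, fun E Ps δ => .head (.repl P) ?_⟩
    rw [add_assoc, Multiset.singleton_add]
    exact hY E _ δ
  | inp p h ih =>
    obtain ⟨Y, hY⟩ := ih
    exact ⟨Y, fun E Ps δ => .head (.inp _ _ _ (.pub p) (.pub c)) (hY E Ps δ)⟩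

/-- The additional inputs in front of a process can be executed first. -/
theorem Refines.exists_unfolds {S : Signature.{u}} {c : S.PN} {P Q : Proc S 0} :
    Refines c P Q → ∃ Q', Unfolds c Q Q' ∧ Congruent (Refines c) P Q'
  | .congr h => ⟨Q, .refl Q, h⟩
  | .skip p h =>
    have ⟨Q', h₁, h₂⟩ := h.exists_unfolds
    ⟨Q', .inp p h₁, h₂⟩

end Unfolding

/-! ### The simulation -/

section Simulation

variable {C : Calculus.{u}} {c : C.PN} {B : Proc C.toSignature 0}

/-- `Offers c B P`: the process `P` is a parallel composition of replicated processes, for each of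
which `B` unfolds to a process that it refines. -/
inductive Offers {S : Signature.{u}} (c : S.PN) (B : Proc S 0) : Proc S 0 → Prop
  | nil : Offers c B .nil
  | par {P Q : Proc S 0} (hP : Offers c B P) (hQ : Offers c B Q) : Offers c B (.par P Q)
  | repl {P Q : Proc S 0} (hQ : Unfolds c B Q) (hP : Refines c P Q) : Offers c B (.repl P)

/-- `Matches c B Ps Qs`: the running processes `Qs` contain `!B`, and separately for each process in
`Ps` one that it refines, where nothing is required for the processes that are offered by `B`. -/
inductive Matches {S : Signature.{u}} (c : S.PN) (B : Proc S 0) :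
    Multiset (Proc S 0) → Multiset (Proc S 0) → Prop
  | zero (Qs : Multiset (Proc S 0)) : Matches c B 0 (.repl B ::ₘ Qs)
  | offered {P : Proc S 0} {Ps Qs : Multiset (Proc S 0)} (hP : Offers c B P)
      (h : Matches c B Ps Qs) : Matches c B (P ::ₘ Ps) Qs
  | refines {P Q : Proc S 0} {Ps Qs : Multiset (Proc S 0)} (hP : Refines c P Q)
      (h : Matches c B Ps Qs) : Matches c B (P ::ₘ Ps) (Q ::ₘ Qs)

theorem Matches.repl_mem {Ps Qs : Multiset (Proc C.toSignature 0)} (h : Matches c B Ps Qs) :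
    .repl B ∈ Qs := by
  induction h with
  | zero Qs => exact Multiset.mem_cons_self _ _
  | offered _ _ ih => exact ih
  | refines _ _ ih => exact Multiset.mem_cons_of_mem ih

theorem Matches.add_left {Ps Qs : Multiset (Proc C.toSignature 0)} (h : Matches c B Ps Qs)
    (Y : Multiset (Proc C.toSignature 0)) : Matches c B Ps (Y + Qs) := by
  induction h with
  | zero Qs => rw [Multiset.add_cons]; exact .zero _
  | offered hP _ ih => exact .offered hP ih
  | refines hP _ ih => rw [Multiset.add_cons]; exact .refines hP ih

theorem Matches.of_cons {P : Proc C.toSignature 0} {Ps Qs : Multiset (Proc C.toSignature 0)}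
    (h : Matches c B (P ::ₘ Ps) Qs) :
    (Offers c B P ∧ Matches c B Ps Qs) ∨
      ∃ Q Qs', Qs = Q ::ₘ Qs' ∧ Refines c P Q ∧ Matches c B Ps Qs' := by
  generalize hR : P ::ₘ Ps = Rs at h
  induction h generalizing Ps with
  | zero Qs => exact absurd hR (Multiset.cons_ne_zero)
  | @offered P' Ps' Qs hP h ih =>
    rcases Multiset.cons_eq_cons.1 hR with ⟨rfl, rfl⟩ | ⟨-, Rs, rfl, rfl⟩
    · exact .inl ⟨hP, h⟩
    · rcases ih rfl with ⟨h₁, h₂⟩ | ⟨Q, Qs', rfl, h₁, h₂⟩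
      · exact .inl ⟨h₁, .offered hP h₂⟩
      · exact .inr ⟨Q, Qs', rfl, h₁, .offered hP h₂⟩
  | @refines P' Q' Ps' Qs hP h ih =>
    rcases Multiset.cons_eq_cons.1 hR with ⟨rfl, rfl⟩ | ⟨-, Rs, rfl, rfl⟩
    · exact .inr ⟨Q', Qs, rfl, hP, h⟩
    · rcases ih rfl with ⟨h₁, h₂⟩ | ⟨Q, Qs', rfl, h₁, h₂⟩
      · exact .inl ⟨h₁, .refines hP h₂⟩
      · exact .inr ⟨Q, Q' ::ₘ Qs', Multiset.cons_swap _ _ _, h₁, .refines hP h₂⟩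

/-- If a refining process is about to run, the refined one can be brought, silently, into the
same form. -/
theorem Matches.exists_congruent {P : Proc C.toSignature 0}
    {Ps Qs : Multiset (Proc C.toSignature 0)} (h : Matches c B (P ::ₘ Ps) Qs)
    (hP : ¬ Offers c B P) (E : Set C.FN) (δ : List (Term C.toSignature 0)) :
    ∃ Q Qs', SilentSteps C ⟨E, Qs, δ⟩ ⟨E, Q ::ₘ Qs', δ⟩ ∧ Congruent (Refines c) P Q ∧
      Matches c B Ps Qs' := by
  rcases h.of_cons with ⟨h, -⟩ | ⟨Q, Qs, rfl, hQ, h⟩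
  · exact absurd h hP
  · obtain ⟨Q', h₁, h₂⟩ := hQ.exists_unfolds
    obtain ⟨Y, hY⟩ := h₁.silentSteps
    exact ⟨Q', Y + Qs, hY E Qs δ, h₂, h.add_left Y⟩

/-- An offered replication is unfolded by having `!B` produce a process that the copy refines. -/
theorem Matches.unfold_offered {P : Proc C.toSignature 0}
    {Ps Qs : Multiset (Proc C.toSignature 0)} (h : Matches c B Ps Qs)
    (hP : Offers c B (.repl P)) (E : Set C.FN) (δ : List (Term C.toSignature 0)) :
    ∃ Qs', SilentSteps C ⟨E, Qs, δ⟩ ⟨E, Qs', δ⟩ ∧ Matches c B (P ::ₘ .repl P ::ₘ Ps) Qs' := by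
  have hP' := hP
  cases hP with
  | @repl _ Q hQ hr =>
    obtain ⟨Qs', rfl⟩ := Multiset.exists_cons_of_mem h.repl_mem
    obtain ⟨Y, hY⟩ := hQ.silentSteps
    exact ⟨Q ::ₘ (Y + .repl B ::ₘ Qs'), .head (.repl B) (hY E _ δ),
      .refines hr (.offered hP' (h.add_left Y))⟩

/-- Configurations with the same generated names and frame and with matching processes. -/
inductive Simulates {S : Signature.{u}} (c : S.PN) (B : Proc S 0) : Config S → Config S → Prop
  | mk (E : Set S.FN) {Ps Qs : Multiset (Proc S 0)} (δ : List (Term S 0))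
      (h : Matches c B Ps Qs) : Simulates c B ⟨E, Ps, δ⟩ ⟨E, Qs, δ⟩

/-- A transition, preceded by silent ones; possibly none at all if the label is empty. -/
def WeakStep (C : Calculus.{u}) (κ : Config C.toSignature) :
    Option (Event C.toSignature) → Config C.toSignature → Prop
  | none, κ' => SilentSteps C κ κ'
  | some F, κ' => EventStep C κ F κ'

theorem SilentSteps.weakStep {κ κ₁ κ₂ : Config C.toSignature} {l : Option (Event C.toSignature)}
    (h : SilentSteps C κ κ₁) (hs : Step C κ₁ l κ₂) : WeakStep C κ l κ₂ := by
  cases l with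
  | none => exact h.tail hs
  | some F => exact ⟨κ₁, κ₂, h, hs, .refl⟩

theorem Simulates.step {κ κ₁ η : Config C.toSignature} {l : Option (Event C.toSignature)}
    (h : Simulates c B κ η) (hs : Step C κ l κ₁) :
    ∃ η₁, WeakStep C η l η₁ ∧ Simulates c B κ₁ η₁ := by
  obtain ⟨E, δ, h⟩ := h
  cases hs with
  | null =>
    rcases h.of_cons with ⟨-, h⟩ | ⟨Q, Qs, rfl, hQ, h⟩
    · exact ⟨_, .refl, .mk E δ h⟩
    · -- The partner of a null process stays behind as a superfluous process.
      exact ⟨_, .refl, .mk E δ (by simpa using h.add_left {Q})⟩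
  | par P Q =>
    rcases h.of_cons with ⟨hP, h⟩ | ⟨Q', Qs, rfl, hQ, h⟩
    · cases hP with
      | par h₁ h₂ => exact ⟨_, .refl, .mk E δ (.offered h₁ (.offered h₂ h))⟩
    · obtain ⟨Q'', h₁, h₂⟩ := hQ.exists_unfolds
      obtain ⟨Y, hY⟩ := h₁.silentSteps
      cases h₂ with
      | par hP hQ =>
        exact ⟨_, SilentSteps.weakStep (hY E Qs δ) (.par _ _),
          .mk E δ (.refines hP (.refines hQ (h.add_left Y)))⟩
  | repl P =>
    rcases h.of_cons with ⟨hP, h⟩ | ⟨Q', Qs, rfl, hQ, h⟩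
    · obtain ⟨Qs', h₁, h₂⟩ := h.unfold_offered hP E δ
      exact ⟨_, h₁, .mk E δ h₂⟩
    · obtain ⟨Q'', h₁, h₂⟩ := hQ.exists_unfolds
      obtain ⟨Y, hY⟩ := h₁.silentSteps
      cases h₂ with
      | repl hP =>
        exact ⟨_, SilentSteps.weakStep (hY E Qs δ) (.repl _),
          .mk E δ (.refines hP (.refines (.congr (.repl hP)) (h.add_left Y)))⟩
  | new P b hb =>
    obtain ⟨Q, Qs, h₁, h₂, h₃⟩ := h.exists_congruent nofun E δ
    cases h₂ with
    | new hP => exact ⟨_, h₁.weakStep (.new _ b hb), .mk _ δ (.refines (hP _) h₃)⟩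
  | out t M P ht =>
    obtain ⟨Q, Qs, h₁, h₂, h₃⟩ := h.exists_congruent nofun E δ
    cases h₂ with
    | out _ _ hP => exact ⟨_, h₁.weakStep (.out t M _ ht), .mk E _ (.refines hP h₃)⟩
  | inp t M P hM ht =>
    obtain ⟨Q, Qs, h₁, h₂, h₃⟩ := h.exists_congruent nofun E δ
    cases h₂ with
    | inp _ hP => exact ⟨_, h₁.weakStep (.inp t M _ hM ht), .mk E δ (.refines (hP _) h₃)⟩
  | ifTrue M P Q =>
    obtain ⟨Q, Qs, h₁, h₂, h₃⟩ := h.exists_congruent nofun E δ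
    cases h₂ with
    | ite _ _ hP hQ => exact ⟨_, h₁.weakStep (.ifTrue M _ _), .mk E δ (.refines hP h₃)⟩
  | ifFalse M N P Q hMN =>
    obtain ⟨Q, Qs, h₁, h₂, h₃⟩ := h.exists_congruent nofun E δ
    cases h₂ with
    | ite _ _ hP hQ => exact ⟨_, h₁.weakStep (.ifFalse M N _ _ hMN), .mk E δ (.refines hQ h₃)⟩
  | letSucc g Ms P Q t ht =>
    obtain ⟨Q, Qs, h₁, h₂, h₃⟩ := h.exists_congruent nofun E δ
    cases h₂ with
    | letd _ _ hP hQ =>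
      exact ⟨_, h₁.weakStep (.letSucc g Ms _ _ t ht), .mk E δ (.refines (hP t) h₃)⟩
  | letFail g Ms P Q hg =>
    obtain ⟨Q, Qs, h₁, h₂, h₃⟩ := h.exists_congruent nofun E δ
    cases h₂ with
    | letd _ _ hP hQ =>
      exact ⟨_, h₁.weakStep (.letFail g Ms _ _ hg), .mk E δ (.refines hQ h₃)⟩
  | event F Ms P =>
    obtain ⟨Q, Qs, h₁, h₂, h₃⟩ := h.exists_congruent nofun E δ
    cases h₂ with
    | event _ _ hP => exact ⟨_, h₁.weakStep (.event F Ms _), .mk E δ (.refines hP h₃)⟩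

theorem Simulates.silentSteps {κ κ₁ η : Config C.toSignature}
    (h : Simulates c B κ η) (hs : SilentSteps C κ κ₁) :
    ∃ η₁, SilentSteps C η η₁ ∧ Simulates c B κ₁ η₁ := by
  induction hs with
  | refl => exact ⟨η, .refl, h⟩
  | tail _ hs ih =>
    obtain ⟨η₁, h₁, h₂⟩ := ih
    obtain ⟨η₂, h₃, h₄⟩ := h₂.step hs
    exact ⟨η₂, h₁.trans h₃, h₄⟩

theorem Simulates.eventStep {κ κ₁ η : Config C.toSignature} {F : Event C.toSignature}
    (h : Simulates c B κ η) (hs : EventStep C κ F κ₁) :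
    ∃ η₁, EventStep C η F η₁ ∧ Simulates c B κ₁ η₁ := by
  obtain ⟨κ₂, κ₃, hs₁, hs₂, hs₃⟩ := hs
  obtain ⟨η₁, h₁, h⟩ := h.silentSteps hs₁
  obtain ⟨η₂, ⟨η₃, η₄, h₂, h₃, h₄⟩, h⟩ := h.step hs₂
  obtain ⟨η₅, h₅, h⟩ := h.silentSteps hs₃
  exact ⟨η₅, ⟨η₃, η₄, h₁.trans h₂, h₃, h₄.trans h₅⟩, h⟩

theorem Simulates.run {κ κ₁ η : Config C.toSignature} {Fs : List (Event C.toSignature)}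
    (h : Simulates c B κ η) (hs : Run C κ Fs κ₁) : ∃ η₁, Run C η Fs η₁ := by
  induction hs generalizing η with
  | nil => exact ⟨η, .nil η⟩
  | cons hF _ ih =>
    obtain ⟨η₁, h₁, h⟩ := h.eventStep hF
    obtain ⟨η₂, h₂⟩ := ih h
    exact ⟨η₂, .cons h₁ h₂⟩

theorem Offers.traces_subset {P : Proc C.toSignature 0} (h : Offers c B P) :
    traces C P ⊆ traces C (.repl B) := by
  rintro Fs ⟨κ, hκ⟩
  exact Simulates.run (.mk ∅ [] (.offered h (.zero 0))) hκ

end Simulation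

/-! ### The compiled process and the model -/

section Model

variable {S : Signature.{u}} {c : S.PN} {B : Proc S 0}

theorem Offers.bigPar {α : Type u} {A : Finset α} {P : α → Proc S 0}
    (h : ∀ a, Offers c B (P a)) : Offers c B (bigPar A P) := by
  unfold InfraTrace.bigPar
  induction A.toList with
  | nil => exact .nil
  | cons a l ih => exact .par (h a) ih

/-- The adversary sends the data `d`, `i`, `s` of a node to a subprocess that waits for them. -/
theorem unfolds_receiveNode (c : S.PN) (K : Proc S 4) (p d i s : S.PN) :
    Unfolds c ((LocalSubprocesses.receiveNode c K).inst (.pub p)) (K.call ![p, d, i, s]) := by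
  refine .repl (.inp d ?_)
  rw [Proc.subst_liftSubst_inst]
  refine .inp i ?_
  rw [Proc.subst_liftSubst_inst]
  refine .inp s ?_
  rw [Proc.subst_liftSubst_inst]
  refine .repl ?_
  convert Unfolds.refl _ using 1
  rw [Proc.call]
  congr 1
  funext x
  fin_cases x <;> rfl

theorem call_ignoreProvider (K : Proc S 3) (p d i s : S.PN) :
    (LocalSubprocesses.ignoreProvider K).call ![p, d, i, s] = K.call ![d, i, s] := by
  rw [Proc.call, LocalSubprocesses.ignoreProvider, Proc.subst_subst]
  rfl

theorem InsertInputs.refines {m n : ℕ} {P : Proc S (m + 1)} {Q : Proc S n}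
    (h : InsertInputs c P Q) {v : Fin (m + 1) → S.PN} {w : Fin n → S.PN}
    (hvw : ∀ x : Fin n, w x = v (Fin.ofNat (m + 1) x)) :
    Refines c (P.call v) (Q.call w) := by
  have := h.refines_call fun k => v (Fin.ofNat (m + 1) k)
  convert this using 2
  · simp
  · exact funext hvw

end Model

namespace LocalSubprocesses

variable {S : Signature.{u}} {c : S.PN} {R : Subprocesses S} {L : LocalSubprocesses S}

/-- The body of the outermost replication of the model. -/
def body (L : LocalSubprocesses S) (c : S.PN) : Proc S 0 :=
  .inp (.pub c)
    (.par (receiveNode c L.client)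
      (.par (receiveNode c L.server)
        (.par (receiveNode c (ignoreProvider L.res))
          (.par (receiveNode c (ignoreProvider L.ns))
            (receiveNode c (ignoreProvider L.rns))))))

/-- Every subprocess of the compiled process is available in the model, since the adversary can send
the names of the nodes concerned on `c`. -/
theorem ReceivesPartners.offers_compile (hL : L.ReceivesPartners c R)
    (G : PropertyGraph.{u, v} S.PN) : Offers c (L.body c) (R.compile G) := by
  refine .bigPar fun p => .par (.bigPar ?_) (.par (.bigPar ?_) (.par (.bigPar ?_)
    (.par (.bigPar ?_) (.bigPar ?_))))
  · rintro ⟨d, i, s, e, j, s₁, r, k, s₂, t₁, t₂, q⟩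
    refine .repl (.inp p (.parLeft (unfolds_receiveNode c L.client p d i s)))
      (hL.client.refines fun x => ?_)
    fin_cases x <;> rfl
  · rintro ⟨d, i, s, e, j, s₁, t, q⟩
    refine .repl (.inp p (.parRight (.parLeft (unfolds_receiveNode c L.server p d i s))))
      (hL.server.refines fun x => ?_)
    fin_cases x <;> rfl
  · rintro ⟨d, i, s, e, j, s₁, n, k, s₂, n', k', s₃, t₁, t₂, t₃⟩
    have h := unfolds_receiveNode c (ignoreProvider L.res) p d i s
    rw [call_ignoreProvider] at h
    refine .repl (.inp p (.parRight (.parRight (.parLeft h)))) (hL.res.refines fun x => ?_)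
    fin_cases x <;> rfl
  · rintro ⟨d, i, s, r, j, s₁, t⟩
    have h := unfolds_receiveNode c (ignoreProvider L.ns) p d i s
    rw [call_ignoreProvider] at h
    refine .repl (.inp p (.parRight (.parRight (.parRight (.parLeft h)))))
      (hL.ns.refines fun x => ?_)
    fin_cases x <;> rfl
  · rintro ⟨d, i, s, r, j, s₁, t⟩
    have h := unfolds_receiveNode c (ignoreProvider L.rns) p d i s
    rw [call_ignoreProvider] at h
    refine .repl (.inp p (.parRight (.parRight (.parRight (.parRight h)))))
      (hL.rns.refines fun x => ?_)
    fin_cases x <;> rfl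

end LocalSubprocesses

end InfraTrace

theorem theorem3 (C : InfraTrace.Calculus.{u}) (c : C.PN)
    (R : InfraTrace.Subprocesses C.toSignature) (L : InfraTrace.LocalSubprocesses C.toSignature)
    (hL : L.ReceivesPartners c R) :
    ∀ G : InfraTrace.PropertyGraph.{u, v} C.PN,
      InfraTrace.traces C (R.compile G) ⊆ InfraTrace.traces C (L.model c) :=
  fun G => (hL.offers_compile G).traces_subset
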